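/- Let $(M^n,\langle\cdot,\cdot\rangle)$ be a simply connected (in particular connected) smooth Riemannian manifold and let $f:M^n\to\mathbb R^{n+1}$ be a smooth isometric immersion with smooth unit normal vector field $N$. Let $A$ be the shape operator associated with $N$, so that $dN(X)=-df(AX)$, and let $\nabla$ be the Levi-Civita connection of $\langle\cdot,\cdot\rangle$. Let $Q$ be a Codazzi tensor on $M^n$, i.e. a smooth self-adjoint $(1,1)$-tensor field with $(\nabla_XQ)Y=(\nabla_YQ)X$ for all tangent vector fields $X,Y$, where $(\nabla_XQ)Y=\nabla_X(QY)-Q(\nabla_XY)$. Assume that $Q$ is non-singular (invertible at every point) and that $Q\circ A=A\circ Q$. Then there exist: (i) a smooth immersion $F:M^n\to\mathbb R^{n+1}$ such that $dF=df\circ Q$, and (ii) smooth functions $g,h:M^n\to\mathbb R$ such that $A(\operatorname{grad} g)=-\operatorname{grad} h$, $QX=\nabla_X\operatorname{grad} g-hAX$ for every tangent vector $X$, and $F=df(\operatorname{grad} g)+hN$. Furthermore, $\widetilde{\langle X,Y\rangle}=\langle Q^2X,Y\rangle$ defines a Riemannian metric on $M^n$, and $F$ is an isometric immersion of $(M^n,\widetilde{\langle\cdot,\cdot\rangle})$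 into $\mathbb R^{n+1}$. -/

import Mathlib

open Bundle NormedSpace VectorField
open scoped Manifold ContDiff

namespace CodazziHypersurface

noncomputable section

/-- A smooth Riemannian metric on an `n`-dimensional manifold `M`. -/
abbrev Metric (n : ℕ) (M : Type*) [TopologicalSpace M]
    [ChartedSpace (EuclideanSpace ℝ (Fin n)) M] [IsManifold (𝓡 n) ∞ M] :=
  ContMDiffRiemannianMetric (𝓡 n) ∞ (EuclideanSpace ℝ (Fin n))
    (fun x : M ↦ TangentSpace (𝓡 n) x)

variable {n : ℕ} {M : Type*} [TopologicalSpace M]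
  [ChartedSpace (EuclideanSpace ℝ (Fin n)) M] [IsManifold (𝓡 n) ∞ M]

instance instFiniteDimensionalTangent (x : M) : FiniteDimensional ℝ (TangentSpace (𝓡 n) x) :=
  inferInstanceAs (FiniteDimensional ℝ (EuclideanSpace ℝ (Fin n)))

instance instT2Tangent (x : M) : T2Space (TangentSpace (𝓡 n) x) :=
  inferInstanceAs (T2Space (EuclideanSpace ℝ (Fin n)))

/-- A vector field on `M` (not necessarily smooth). -/
abbrev VField (n : ℕ) (M : Type*) [TopologicalSpace M]
    [ChartedSpace (EuclideanSpace ℝ (Fin n)) M] :=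
  Π x : M, TangentSpace (𝓡 n) x

/-- The vector field `X` is differentiable at `x`. -/
abbrev DiffFieldAt (X : VField n M) (x : M) : Prop :=
  MDifferentiableAt (𝓡 n) ((𝓡 n).prod 𝓘(ℝ, EuclideanSpace ℝ (Fin n)))
    (fun y ↦ TotalSpace.mk' (EuclideanSpace ℝ (Fin n))
      (E := fun y : M ↦ TangentSpace (𝓡 n) y) y (X y)) x

/-- The vector field `X` is smooth at `x`. -/
abbrev SmoothFieldAt (X : VField n M) (x : M) : Prop :=
  ContMDiffAt (𝓡 n) ((𝓡 n).prod 𝓘(ℝ, EuclideanSpace ℝ (Fin n))) ∞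
    (fun y ↦ TotalSpace.mk' (EuclideanSpace ℝ (Fin n))
      (E := fun y : M ↦ TangentSpace (𝓡 n) y) y (X y)) x

/-! ### The musical isomorphism and the gradient -/

theorem flat_injective (m : Metric n M) (x : M) :
    Function.Injective
      ((ContinuousLinearMap.coeLM ℝ).comp (m.inner x : TangentSpace (𝓡 n) x →ₗ[ℝ]
        (TangentSpace (𝓡 n) x →L[ℝ] ℝ)) :
        TangentSpace (𝓡 n) x →ₗ[ℝ] Module.Dual ℝ (TangentSpace (𝓡 n) x)) := by
  rw [injective_iff_map_eq_zero]
  intro v hv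
  by_contra h
  have h1 := m.pos x v h
  have h2 := LinearMap.congr_fun hv v
  simp at h2
  exact h1.ne' h2

/-- The isomorphism `v ↦ ⟨v, ·⟩` from the tangent space at `x` to its dual. -/
def flat (m : Metric n M) (x : M) :
    TangentSpace (𝓡 n) x ≃ₗ[ℝ] Module.Dual ℝ (TangentSpace (𝓡 n) x) :=
  LinearEquiv.ofInjectiveOfFinrankEq _ (flat_injective m x) Subspace.dual_finrank_eq.symm

/-- The tangent vector `v` at `x` with `⟨v, w⟩ = ℓ w` for all `w`. -/
def sharp (m : Metric n M) (x : M) :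
    (TangentSpace (𝓡 n) x →L[ℝ] ℝ) →ₗ[ℝ] TangentSpace (𝓡 n) x :=
  (flat m x).symm.toLinearMap.comp (ContinuousLinearMap.coeLM ℝ)

theorem inner_sharp (m : Metric n M) (x : M) (ℓ : TangentSpace (𝓡 n) x →L[ℝ] ℝ)
    (w : TangentSpace (𝓡 n) x) : m.inner x (sharp m x ℓ) w = ℓ w :=
  LinearMap.congr_fun ((flat m x).apply_symm_apply (ℓ : Module.Dual ℝ (TangentSpace (𝓡 n) x))) w

/-- The gradient of a function `φ`: `⟨grad φ, w⟩ = dφ(w)`. -/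
def grad (m : Metric n M) (φ : M → ℝ) (x : M) : TangentSpace (𝓡 n) x :=
  sharp m x (mvfderiv (𝓡 n) φ x)

/-! ### The Levi-Civita connection -/

theorem mdifferentiableAt_inner (m : Metric n M) {x : M} {X Y : VField n M}
    (hX : DiffFieldAt X x) (hY : DiffFieldAt Y x) :
    MDifferentiableAt (𝓡 n) 𝓘(ℝ, ℝ) (fun y ↦ m.inner y (X y) (Y y)) x := by
  let _ : RiemannianBundle (fun x : M ↦ TangentSpace (𝓡 n) x) := ⟨m.toRiemannianMetric⟩
  exact MDifferentiableAt.inner_bundle (F := EuclideanSpace ℝ (Fin n)) hX hY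

/-- The right-hand side of the Koszul formula
`2⟨∇_X Y, Z⟩ = X⟨Y,Z⟩ + Y⟨Z,X⟩ - Z⟨X,Y⟩ + ⟨[X,Y],Z⟩ - ⟨[Y,Z],X⟩ + ⟨[Z,X],Y⟩`, halved. -/
def koszul (m : Metric n M) (Y X Z : VField n M) (x : M) : ℝ :=
  (1 / 2 : ℝ) *
    (mvfderiv (𝓡 n) (fun y ↦ m.inner y (Y y) (Z y)) x (X x)
      + mvfderiv (𝓡 n) (fun y ↦ m.inner y (Z y) (X y)) x (Y x)
      - mvfderiv (𝓡 n) (fun y ↦ m.inner y (X y) (Y y)) x (Z x)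
      + m.inner x (mlieBracket (𝓡 n) X Y x) (Z x)
      - m.inner x (mlieBracket (𝓡 n) Y Z x) (X x)
      + m.inner x (mlieBracket (𝓡 n) Z X x) (Y x))

section

variable (m : Metric n M) {x : M} {X X' Y Y' Z Z' : VField n M} {f : M → ℝ}

theorem inner_add_left' : (fun y ↦ m.inner y ((X + X') y) (Y y)) =
    (fun y ↦ m.inner y (X y) (Y y)) + fun y ↦ m.inner y (X' y) (Y y) := by
  ext y; simp

theorem inner_add_right' : (fun y ↦ m.inner y (Y y) ((X + X') y)) =
    (fun y ↦ m.inner y (Y y) (X y)) + fun y ↦ m.inner y (Y y) (X' y) := by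
  ext y; simp

theorem inner_smul_left' : (fun y ↦ m.inner y ((f • X) y) (Y y)) =
    f * fun y ↦ m.inner y (X y) (Y y) := by
  ext y; simp

theorem inner_smul_right' : (fun y ↦ m.inner y (Y y) ((f • X) y)) =
    f * fun y ↦ m.inner y (Y y) (X y) := by
  ext y; simp

theorem koszul_add_left (hY : DiffFieldAt Y x) (hX : DiffFieldAt X x)
    (hX' : DiffFieldAt X' x) (hZ : DiffFieldAt Z x) :
    koszul m Y (X + X') Z x = koszul m Y X Z x + koszul m Y X' Z x := by
  simp only [koszul, inner_add_left', inner_add_right']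
  rw [mvfderiv_add (mdifferentiableAt_inner m hZ hX) (mdifferentiableAt_inner m hZ hX'),
    mvfderiv_add (mdifferentiableAt_inner m hX hY) (mdifferentiableAt_inner m hX' hY),
    mlieBracket_add_left hX hX', mlieBracket_add_right hX hX']
  simp
  ring

theorem koszul_add_right (hY : DiffFieldAt Y x) (hX : DiffFieldAt X x)
    (hZ : DiffFieldAt Z x) (hZ' : DiffFieldAt Z' x) :
    koszul m Y X (Z + Z') x = koszul m Y X Z x + koszul m Y X Z' x := by
  simp only [koszul, inner_add_left', inner_add_right']
  rw [mvfderiv_add (mdifferentiableAt_inner m hZ hX) (mdifferentiableAt_inner m hZ' hX),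
    mvfderiv_add (mdifferentiableAt_inner m hY hZ) (mdifferentiableAt_inner m hY hZ'),
    mlieBracket_add_left hZ hZ', mlieBracket_add_right hZ hZ']
  simp
  ring

theorem koszul_add_field (hY : DiffFieldAt Y x) (hY' : DiffFieldAt Y' x)
    (hX : DiffFieldAt X x) (hZ : DiffFieldAt Z x) :
    koszul m (Y + Y') X Z x = koszul m Y X Z x + koszul m Y' X Z x := by
  simp only [koszul, inner_add_left', inner_add_right']
  rw [mvfderiv_add (mdifferentiableAt_inner m hY hZ) (mdifferentiableAt_inner m hY' hZ),
    mvfderiv_add (mdifferentiableAt_inner m hX hY) (mdifferentiableAt_inner m hX hY'),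
    mlieBracket_add_left hY hY', mlieBracket_add_right hY hY']
  simp
  ring

theorem koszul_smul_left (hf : MDifferentiableAt (𝓡 n) 𝓘(ℝ, ℝ) f x) (hY : DiffFieldAt Y x) (hX : DiffFieldAt X x)
    (hZ : DiffFieldAt Z x) :
    koszul m Y (f • X) Z x = f x * koszul m Y X Z x := by
  simp only [koszul, inner_smul_left', inner_smul_right']
  rw [mvfderiv_mul hf (mdifferentiableAt_inner m hZ hX),
    mvfderiv_mul hf (mdifferentiableAt_inner m hX hY),
    mlieBracket_smul_left hf hX, mlieBracket_smul_right hf hX]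
  simp [m.symm x (Z x) (X x)]
  ring

theorem koszul_smul_right (hf : MDifferentiableAt (𝓡 n) 𝓘(ℝ, ℝ) f x) (hY : DiffFieldAt Y x) (hX : DiffFieldAt X x)
    (hZ : DiffFieldAt Z x) :
    koszul m Y X (f • Z) x = f x * koszul m Y X Z x := by
  simp only [koszul, inner_smul_left', inner_smul_right']
  rw [mvfderiv_mul hf (mdifferentiableAt_inner m hZ hX),
    mvfderiv_mul hf (mdifferentiableAt_inner m hY hZ),
    mlieBracket_smul_left hf hZ, mlieBracket_smul_right hf hZ]
  simp [m.symm x (Z x) (X x), m.symm x (Z x) (Y x)]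
  ring

theorem koszul_smul_field (hf : MDifferentiableAt (𝓡 n) 𝓘(ℝ, ℝ) f x) (hY : DiffFieldAt Y x) (hX : DiffFieldAt X x)
    (hZ : DiffFieldAt Z x) :
    koszul m (f • Y) X Z x =
      f x * koszul m Y X Z x + mvfderiv (𝓡 n) f x (X x) * m.inner x (Y x) (Z x) := by
  simp only [koszul, inner_smul_left', inner_smul_right']
  rw [mvfderiv_mul hf (mdifferentiableAt_inner m hY hZ),
    mvfderiv_mul hf (mdifferentiableAt_inner m hX hY),
    mlieBracket_smul_left hf hY, mlieBracket_smul_right hf hY]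
  simp [m.symm x (Y x) (X x)]
  ring

/-- For a vector field `Y` differentiable at `x`, the bilinear form `(u, w) ↦ ⟨∇_u Y, w⟩`
on the tangent space at `x`. -/
def koszulForm (Y : VField n M) (x : M) (hY : DiffFieldAt Y x) :
    TangentSpace (𝓡 n) x →L[ℝ] TangentSpace (𝓡 n) x →L[ℝ] ℝ :=
  TensorialAt.mkHom₂ (I := 𝓡 n) (F := EuclideanSpace ℝ (Fin n)) (F' := EuclideanSpace ℝ (Fin n))
    (fun X Z ↦ koszul m Y X Z x) x
    (fun _ hZ ↦ ⟨fun hf hX ↦ koszul_smul_left m hf hY hX hZ,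
      fun hX hX' ↦ koszul_add_left m hY hX hX' hZ⟩)
    (fun _ hX ↦ ⟨fun hf hZ ↦ koszul_smul_right m hf hY hX hZ,
      fun hZ hZ' ↦ koszul_add_right m hY hX hZ hZ'⟩)

theorem koszulForm_apply (hY : DiffFieldAt Y x) (hX : DiffFieldAt X x)
    (hZ : DiffFieldAt Z x) : koszulForm m Y x hY (X x) (Z x) = koszul m Y X Z x :=
  TensorialAt.mkHom₂_apply _ _ hX hZ

open Classical in
/-- `leviCivitaFun m Y x u` is `∇_u Y` at `x`; it is `0` if `Y` is not differentiable at `x`. -/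
def leviCivitaFun (Y : VField n M) (x : M) :
    TangentSpace (𝓡 n) x →L[ℝ] TangentSpace (𝓡 n) x :=
  if hY : DiffFieldAt Y x then
    LinearMap.toContinuousLinearMap ((sharp m x).comp (koszulForm m Y x hY).toLinearMap)
  else 0

theorem inner_leviCivitaFun (hY : DiffFieldAt Y x) (hX : DiffFieldAt X x)
    (hZ : DiffFieldAt Z x) :
    m.inner x (leviCivitaFun m Y x (X x)) (Z x) = koszul m Y X Z x := by
  rw [leviCivitaFun, dif_pos hY, ← koszulForm_apply m hY hX hZ]
  exact inner_sharp m x _ _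

theorem eq_of_inner_eq {u v : TangentSpace (𝓡 n) x}
    (h : ∀ Z : VField n M, DiffFieldAt Z x →
      m.inner x u (Z x) = m.inner x v (Z x)) : u = v := by
  apply (flat m x).injective
  ext w
  have := h (FiberBundle.extend (EuclideanSpace ℝ (Fin n)) w)
    (FiberBundle.mdifferentiableAt_extend ..)
  rw [FiberBundle.extend_apply_self] at this
  exact this

theorem clm_eq_of_inner_eq {A B : TangentSpace (𝓡 n) x →L[ℝ] TangentSpace (𝓡 n) x}
    (h : ∀ X Z : VField n M, DiffFieldAt X x → DiffFieldAt Z x →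
      m.inner x (A (X x)) (Z x) = m.inner x (B (X x)) (Z x)) : A = B := by
  ext1 u
  have hu := FiberBundle.mdifferentiableAt_extend (𝓡 n) (EuclideanSpace ℝ (Fin n)) u
  apply eq_of_inner_eq m
  intro Z hZ
  simpa using h _ Z hu hZ

/-- The Levi-Civita connection of the metric `m`; `leviCivita m Y x u` is `∇_u Y`. -/
def leviCivita : CovariantDerivative (𝓡 n) (EuclideanSpace ℝ (Fin n))
    (fun x : M ↦ TangentSpace (𝓡 n) x) where
  toFun := leviCivitaFun m
  isCovariantDerivativeOnUniv :=
    { add := by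
        intro Y Y' x hY hY' _
        refine clm_eq_of_inner_eq m fun X Z hX hZ ↦ ?_
        rw [inner_leviCivitaFun m (mdifferentiableAt_add_section hY hY') hX hZ,
          koszul_add_field m hY hY' hX hZ]
        simp [inner_leviCivitaFun m hY hX hZ, inner_leviCivitaFun m hY' hX hZ]
      leibniz := by
        intro Y f x hY hf _
        refine clm_eq_of_inner_eq m fun X Z hX hZ ↦ ?_
        rw [inner_leviCivitaFun m (hf.smul_section hY) hX hZ, koszul_smul_field m hf hY hX hZ]
        simp [inner_leviCivitaFun m hY hX hZ] }

/-- The Levi-Civita connection is torsion-free. -/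
theorem leviCivita_torsion_free (hX : DiffFieldAt X x) (hY : DiffFieldAt Y x) :
    leviCivita m Y x (X x) - leviCivita m X x (Y x) = mlieBracket (𝓡 n) X Y x := by
  refine eq_of_inner_eq m fun Z hZ ↦ ?_
  have h1 := inner_leviCivitaFun m hY hX hZ
  have h2 := inner_leviCivitaFun m hX hY hZ
  have e : ∀ U V : VField n M,
      (fun y ↦ m.inner y (U y) (V y)) = fun y ↦ m.inner y (V y) (U y) :=
    fun U V ↦ funext fun y ↦ m.symm y _ _
  have a : m.inner x (leviCivita m Y x (X x)) (Z x) = koszul m Y X Z x := h1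
  have b : m.inner x (leviCivita m X x (Y x)) (Z x) = koszul m X Y Z x := h2
  rw [map_sub, sub_apply, a, b]
  simp only [koszul]
  rw [e Z X, e Z Y, e Y X, mlieBracket_swap_apply (V := Y) (W := X),
    mlieBracket_swap_apply (V := X) (W := Z), mlieBracket_swap_apply (V := Z) (W := Y)]
  simp
  ring

/-- The Levi-Civita connection is compatible with the metric. -/
theorem leviCivita_metric (hX : DiffFieldAt X x) (hY : DiffFieldAt Y x)
    (hZ : DiffFieldAt Z x) :
    mvfderiv (𝓡 n) (fun y ↦ m.inner y (Y y) (Z y)) x (X x) =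
      m.inner x (leviCivita m Y x (X x)) (Z x) + m.inner x (Y x) (leviCivita m Z x (X x)) := by
  have a : m.inner x (leviCivita m Y x (X x)) (Z x) = koszul m Y X Z x :=
    inner_leviCivitaFun m hY hX hZ
  have b : m.inner x (leviCivita m Z x (X x)) (Y x) = koszul m Z X Y x :=
    inner_leviCivitaFun m hZ hX hY
  have e : ∀ U V : VField n M,
      (fun y ↦ m.inner y (U y) (V y)) = fun y ↦ m.inner y (V y) (U y) :=
    fun U V ↦ funext fun y ↦ m.symm y _ _
  rw [m.symm x (Y x), a, b]
  simp only [koszul]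
  rw [e Z X, e Y X, e Z Y, mlieBracket_swap_apply (V := Y) (W := X),
    mlieBracket_swap_apply (V := X) (W := Z), mlieBracket_swap_apply (V := Z) (W := Y)]
  simp
  ring

end

/-! ### Immersions, shape operators and Codazzi tensors -/

/-- A field of endomorphisms of the tangent spaces, i.e. a (1,1)-tensor field (not necessarily
smooth). -/
abbrev EndoField (n : ℕ) (M : Type*) [TopologicalSpace M]
    [ChartedSpace (EuclideanSpace ℝ (Fin n)) M] :=
  Π x : M, TangentSpace (𝓡 n) x →L[ℝ] TangentSpace (𝓡 n) x

/-- Smoothness of a (1,1)-tensor field, as a section of the bundle `Hom(TM, TM)`. -/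
def EndoField.Smooth (Q : EndoField n M) : Prop :=
  ContMDiff (𝓡 n)
    ((𝓡 n).prod 𝓘(ℝ, EuclideanSpace ℝ (Fin n) →L[ℝ] EuclideanSpace ℝ (Fin n))) ∞
    (fun x ↦ TotalSpace.mk' (EuclideanSpace ℝ (Fin n) →L[ℝ] EuclideanSpace ℝ (Fin n))
      (E := fun x : M ↦ TangentSpace (𝓡 n) x →L[ℝ] TangentSpace (𝓡 n) x) x (Q x))

/-- A Codazzi tensor: a smooth self-adjoint (1,1)-tensor field `Q` such that
`(∇_X Q) Y = (∇_Y Q) X`, where `(∇_X Q) Y = ∇_X (Q Y) - Q (∇_X Y)`, at every point `x` and for all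
vector fields `X`, `Y` that are smooth at `x`. -/
structure IsCodazzi (m : Metric n M) (Q : EndoField n M) : Prop where
  smooth : Q.Smooth
  selfAdjoint : ∀ (x : M) (u v : TangentSpace (𝓡 n) x),
    m.inner x (Q x u) v = m.inner x u (Q x v)
  codazzi : ∀ (x : M) (X Y : VField n M),
    SmoothFieldAt X x → SmoothFieldAt Y x →
      leviCivita m (fun y ↦ Q y (Y y)) x (X x) - Q x (leviCivita m Y x (X x)) =
        leviCivita m (fun y ↦ Q y (X y)) x (Y x) - Q x (leviCivita m X x (Y x))

/-- The differential at `x` of a map into Euclidean space. -/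
abbrev diff {k : ℕ} (f : M → EuclideanSpace ℝ (Fin k)) (x : M) :
    TangentSpace (𝓡 n) x →L[ℝ] EuclideanSpace ℝ (Fin k) :=
  mvfderiv (𝓡 n) f x

/-- A smooth immersion of `M` into Euclidean space. -/
def IsSmoothImmersion {k : ℕ} (f : M → EuclideanSpace ℝ (Fin k)) : Prop :=
  ContMDiff (𝓡 n) (𝓡 k) ∞ f ∧ ∀ x, Function.Injective (diff (n := n) f x)

/-- An isometric immersion of the Riemannian manifold `(M, m)` into Euclidean space. -/
def IsIsometricImmersion {k : ℕ} (m : Metric n M) (f : M → EuclideanSpace ℝ (Fin k)) : Prop :=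
  IsSmoothImmersion (n := n) f ∧
    ∀ (x : M) (u v : TangentSpace (𝓡 n) x), inner ℝ (diff f x u) (diff f x v) = m.inner x u v

/-- A smooth unit normal vector field along `f`. -/
structure IsUnitNormal (f N : M → EuclideanSpace ℝ (Fin (n + 1))) : Prop where
  smooth : ContMDiff (𝓡 n) (𝓡 (n + 1)) ∞ N
  norm_eq_one : ∀ x, ‖N x‖ = 1
  normal : ∀ (x : M) (u : TangentSpace (𝓡 n) x), inner ℝ (diff f x u) (N x) = 0

/-- The shape operator `A` of an isometric immersion `f` associated with the unit normal field `N`,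
given by `⟨A u, v⟩ = -⟨dN(u), df(v)⟩`. -/
def shapeOperator (m : Metric n M) (f N : M → EuclideanSpace ℝ (Fin (n + 1))) : EndoField n M :=
  fun x ↦ LinearMap.toContinuousLinearMap
    { toFun := fun u ↦ -sharp m x ((innerSL ℝ (diff N x u)).comp (diff f x))
      map_add' := fun u v ↦ by simp [ContinuousLinearMap.add_comp]; abel
      map_smul' := fun c u ↦ by simp [ContinuousLinearMap.smul_comp] }

theorem inner_shapeOperator (m : Metric n M) (f N : M → EuclideanSpace ℝ (Fin (n + 1))) (x : M)
    (u v : TangentSpace (𝓡 n) x) :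
    m.inner x (shapeOperator m f N x u) v = -inner ℝ (diff N x u) (diff f x v) := by
  have := inner_sharp m x ((innerSL ℝ (diff N x u)).comp (diff f x)) v
  simp [shapeOperator] at this ⊢
  exact this

end

end CodazziHypersurface

open CodazziHypersurface

/-!
By the Gauss formula, the tangential part of `d(df ∘ Q)` is the Codazzi equation for `Q`, and its
normal part is the antisymmetrization of `⟨AX, QY⟩`, which vanishes because `Q` commutes with `A`.
So `df ∘ Q` is closed. On a simply connected manifold a closed one-form has a primitive: the germs
of its local primitives form a covering space, which has a global section. Let `F` be a primitive of
`df ∘ Q`. The one-form `⟨F, df⟩` is closed because `Q` is self-adjoint; if `g` is a primitive of it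
and `h = ⟨F, N⟩`, then `F = df(grad g) + hN`. Differentiating this with the Gauss and Weingarten
formulas and comparing with `dF = df ∘ Q`, the tangential part is the formula for `Q` and the normal
part is `A(grad g) = -grad h`.
-/

namespace CodazziHypersurface

noncomputable section

open Set Filter Topology

section Gluing

variable {B V : Type*} [TopologicalSpace B] [AddCommGroup V]
  {U : B → Set B} {u : B → B → V}

/-- The bundle of germs of functions that differ by a locally constant function from the functions
`u i`, given on the open sets `U i` with locally constant differences. The coordinate over `U i` of
a germ at `x` is the value at `x` of its difference with `u i`; the fibre `V` is discrete, so that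
continuous sections are families of germs of one function. -/
def translationBundleCore [TopologicalSpace V] [DiscreteTopology V]
    (hU : ∀ i, IsOpen (U i)) (hmem : ∀ i, i ∈ U i)
    (hu : ∀ i j, ∀ x ∈ U i ∩ U j, ∀ᶠ y in 𝓝 x, u i y - u j y = u i x - u j x) :
    FiberBundleCore B B V where
  baseSet := U
  isOpen_baseSet := hU
  indexAt := id
  mem_baseSet_at := hmem
  coordChange i j x v := v + (u i x - u j x)
  coordChange_self := by simp
  continuousOn_coordChange i j := by
    rintro ⟨x, v⟩ ⟨hx, -⟩
    have hsub : ContinuousAt (fun y ↦ u i y - u j y) x :=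
      continuousAt_const.congr ((hu i j x hx).mono fun _ ↦ Eq.symm)
    exact (continuousAt_snd.add (hsub.comp (x := (x, v)) continuousAt_fst)).continuousWithinAt
  coordChange_comp := by intros; abel

theorem exists_eventually_sub_eq_of_simplyConnected [SimplyConnectedSpace B]
    [LocallyPathConnectedSpace B] (hU : ∀ i, IsOpen (U i)) (hmem : ∀ i, i ∈ U i)
    (hu : ∀ i j, ∀ x ∈ U i ∩ U j, ∀ᶠ y in 𝓝 x, u i y - u j y = u i x - u j x) :
    ∃ F : B → V, ∀ x, ∀ᶠ y in 𝓝 x, F y - u x y = F x - u x x := by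
  let _ : TopologicalSpace V := ⊥
  have : DiscreteTopology V := ⟨rfl⟩
  let Z := translationBundleCore hU hmem hu
  have cov : IsCoveringMap Z.proj := FiberBundle.isCoveringMap (F := V) (E := Z.Fiber)
  obtain ⟨x₀⟩ : Nonempty B := inferInstance
  obtain ⟨s, ⟨-, hs⟩, -⟩ := cov.existsUnique_continuousMap_lifts (ContinuousMap.id B) x₀
    (⟨x₀, (0 : V)⟩ : Z.TotalSpace) rfl
  have proj_s (x : B) : (s x).1 = x := congrFun hs x
  let v (x : B) : V := (s x).2
  have coord_s (i x : B) : (Z.localTriv i (s x)).2 = v x + (u x x - u i x) := by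
    change v x + (u (s x).1 (s x).1 - u i (s x).1) = _
    rw [proj_s]
  refine ⟨fun x ↦ v x + u x x, fun x ↦ ?_⟩
  have hcont : ContinuousAt (fun y ↦ (Z.localTriv x (s y)).2) x := by
    have hx : s x ∈ (Z.localTriv x).source :=
      (Z.localTriv x).mem_source.2 (show (s x).1 ∈ U x from (proj_s x).symm ▸ hmem x)
    exact continuousAt_snd.comp
      (((Z.localTriv x).continuousAt hx).comp s.continuous.continuousAt)
  filter_upwards [hcont.eventually_mem ((isOpen_discrete {_}).mem_nhds rfl)] with y hy
  simpa only [coord_s, add_sub_assoc, mem_singleton_iff] using hy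

end Gluing

section OneForms

variable {E : Type*} [NormedAddCommGroup E] [NormedSpace ℝ E]
  {M : Type*} [TopologicalSpace M] [ChartedSpace E M] [IsManifold 𝓘(ℝ, E) ∞ M]
  {V : Type*} [NormedAddCommGroup V] [NormedSpace ℝ V]
  {x₀ y : M} {z : E}

/-- The vector field with constant coordinates `b` in the chart at `x₀`, on the domain of that
chart. -/
def frameField (x₀ : M) (b : E) (y : M) : TangentSpace 𝓘(ℝ, E) y :=
  (trivializationAt E (TangentSpace 𝓘(ℝ, E)) x₀).symmL ℝ y b

theorem contMDiffAt_frameField (hy : y ∈ (chartAt E x₀).source) (b : E) :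
    CMDiffAt ∞ (T% (frameField x₀ b)) y := by
  set e := trivializationAt E (TangentSpace (M := M) 𝓘(ℝ, E)) x₀
  rw [e.contMDiffAt_section_iff (by simpa [e] using hy)]
  refine contMDiffAt_const (c := b) |>.congr_of_eventuallyEq ?_
  filter_upwards [(chartAt E x₀).open_source.mem_nhds hy] with w hw
  rw [frameField, Trivialization.symmL_apply _ hw]
  exact congrArg Prod.snd (Trivialization.apply_mk_symm _ hw b)

theorem contMDiffAt_chartAt_symm (hz : z ∈ (chartAt E x₀).target) :
    CMDiffAt ∞ (chartAt E x₀).symm z :=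
  (contMDiffOn_chart_symm z hz).contMDiffAt ((chartAt E x₀).open_target.mem_nhds hz)

theorem hasMFDerivAt_chartAt (hy : y ∈ (chartAt E x₀).source) :
    HasMFDerivAt 𝓘(ℝ, E) 𝓘(ℝ, E) (chartAt E x₀) y
      ((trivializationAt E (TangentSpace 𝓘(ℝ, E)) x₀).continuousLinearMapAt ℝ y) := by
  rw [TangentBundle.continuousLinearMapAt_trivializationAt hy]
  exact (mdifferentiableAt_extChartAt hy).hasMFDerivAt

theorem hasMFDerivAt_chartAt_symm (hz : z ∈ (chartAt E x₀).target) :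
    HasMFDerivAt 𝓘(ℝ, E) 𝓘(ℝ, E) (chartAt E x₀).symm z
      ((trivializationAt E (TangentSpace 𝓘(ℝ, E)) x₀).symmL ℝ ((chartAt E x₀).symm z)) := by
  have hψ := (mdifferentiableAt_atlas_symm (I := 𝓘(ℝ, E)) (chart_mem_atlas E x₀) hz).hasMFDerivAt
  have h := TangentBundle.symmL_trivializationAt (I := 𝓘(ℝ, E)) ((chartAt E x₀).map_target hz)
  have hzz : extChartAt 𝓘(ℝ, E) x₀ ((chartAt E x₀).symm z) = z := (chartAt E x₀).right_inv hz
  rw [hzz] at h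
  rw [h]
  simpa using hψ

/-- A vector-valued one-form is smooth if it maps smooth vector fields to smooth functions. -/
def SmoothOneForm (η : Π x : M, TangentSpace 𝓘(ℝ, E) x →L[ℝ] V) : Prop :=
  ∀ (x : M) (X : Π x : M, TangentSpace 𝓘(ℝ, E) x), CMDiffAt ∞ (T% X) x →
    CMDiffAt ∞ (fun y ↦ η y (X y)) x

/-- A vector-valued one-form `η` is closed if `X (η Y) - Y (η X) = η [X, Y]` for all smooth vector
fields `X` and `Y`. -/
def ClosedOneForm (η : Π x : M, TangentSpace 𝓘(ℝ, E) x →L[ℝ] V) : Prop :=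
  ∀ (x : M) (X Y : Π x : M, TangentSpace 𝓘(ℝ, E) x),
    CMDiffAt ∞ (T% X) x → CMDiffAt ∞ (T% Y) x →
    mvfderiv 𝓘(ℝ, E) (fun y ↦ η y (Y y)) x (X x) - mvfderiv 𝓘(ℝ, E) (fun y ↦ η y (X y)) x (Y x) =
      η x (mlieBracket 𝓘(ℝ, E) X Y x)

/-- The one-form `η` in the coordinates given by the chart at `x₀`. -/
def chartForm (η : Π x : M, TangentSpace 𝓘(ℝ, E) x →L[ℝ] V) (x₀ : M) (z : E) : E →L[ℝ] V :=
  (η ((chartAt E x₀).symm z)).comp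
    ((trivializationAt E (TangentSpace 𝓘(ℝ, E)) x₀).symmL ℝ ((chartAt E x₀).symm z))

variable {η : Π x : M, TangentSpace 𝓘(ℝ, E) x →L[ℝ] V}

theorem contDiffOn_chartForm [FiniteDimensional ℝ E] (hη : SmoothOneForm η) (x₀ : M) :
    ContDiffOn ℝ ∞ (chartForm η x₀) (chartAt E x₀).target := by
  rw [contDiffOn_clm_apply]
  intro b z hz
  have hηb := hη _ _ (contMDiffAt_frameField ((chartAt E x₀).map_target hz) b)
  exact (hηb.comp z (contMDiffAt_chartAt_symm hz)).contDiffAt.contDiffWithinAt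

theorem hasFDerivAt_comp_chartAt_symm {F : M → V} (hz : z ∈ (chartAt E x₀).target)
    (hF : HasMFDerivAt 𝓘(ℝ, E) 𝓘(ℝ, V) F ((chartAt E x₀).symm z) (η ((chartAt E x₀).symm z))) :
    HasFDerivAt (F ∘ (chartAt E x₀).symm) (chartForm η x₀ z) z :=
  (hF.comp z (hasMFDerivAt_chartAt_symm hz)).hasFDerivAt

/-- The vector field `X` in the coordinates given by the chart at `x₀`. -/
def chartField (X : Π x : M, TangentSpace 𝓘(ℝ, E) x) (x₀ : M) : E → E :=
  mpullback 𝓘(ℝ, E) 𝓘(ℝ, E) (chartAt E x₀).symm X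

variable {X Y : Π x : M, TangentSpace 𝓘(ℝ, E) x}

theorem isInvertible_mfderiv_chartAt_symm (hz : z ∈ (chartAt E x₀).target) :
    (mfderiv 𝓘(ℝ, E) 𝓘(ℝ, E) (chartAt E x₀).symm z).IsInvertible := by
  have h := isInvertible_mfderivWithin_extChartAt_symm (I := 𝓘(ℝ, E)) (x := x₀)
    (y := z) (by simpa using hz)
  rwa [modelWithCornersSelf_coe, range_id, mfderivWithin_univ] at h

theorem chartForm_chartField (hz : z ∈ (chartAt E x₀).target) :
    chartForm η x₀ z (chartField X x₀ z) =
      η ((chartAt E x₀).symm z) (X ((chartAt E x₀).symm z)) := by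
  have h := (isInvertible_mfderiv_chartAt_symm hz).self_apply_inverse (X ((chartAt E x₀).symm z))
  rw [chartForm, ← (hasMFDerivAt_chartAt_symm hz).mfderiv]
  exact congrArg (η _) h

theorem differentiableAt_chartField [CompleteSpace E] (hz : z ∈ (chartAt E x₀).target)
    (hX : CMDiffAt ∞ (T% X) ((chartAt E x₀).symm z)) :
    DifferentiableAt ℝ (chartField X x₀) z := by
  have h := ContMDiffAt.mpullback_vectorField_preimage (n := ∞) hX (contMDiffAt_chartAt_symm hz)
    (isInvertible_mfderiv_chartAt_symm hz) (by simp)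
  exact ((contMDiff_snd_tangentBundle_modelSpace E 𝓘(ℝ, E)).contMDiffAt.comp z
    h).contDiffAt.differentiableAt (by simp)

theorem mlieBracket_eq_lieBracket (V W : E → E) :
    mlieBracket 𝓘(ℝ, E) V W = lieBracket ℝ V W :=
  mlieBracketWithin_univ.symm.trans
    (mlieBracketWithin_eq_lieBracketWithin.trans lieBracketWithin_univ)

theorem chartField_mlieBracket [CompleteSpace E] (hz : z ∈ (chartAt E x₀).target)
    (hX : CMDiffAt ∞ (T% X) ((chartAt E x₀).symm z))
    (hY : CMDiffAt ∞ (T% Y) ((chartAt E x₀).symm z)) :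
    chartField (mlieBracket 𝓘(ℝ, E) X Y) x₀ z =
      lieBracket ℝ (chartField X x₀) (chartField Y x₀) z := by
  have : IsManifold 𝓘(ℝ, E) (minSmoothness ℝ 2) M :=
    IsManifold.of_le (n := ∞) (by simpa using ENat.LEInfty.out)
  rw [← mlieBracket_eq_lieBracket]
  exact mpullback_mlieBracket (hX.mdifferentiableAt (by simp)) (hY.mdifferentiableAt (by simp))
    (contMDiffAt_chartAt_symm hz) (by simpa using ENat.LEInfty.out)

theorem mvfderiv_apply_field [FiniteDimensional ℝ E] (hη : SmoothOneForm η)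
    (hz : z ∈ (chartAt E x₀).target)
    (hX : CMDiffAt ∞ (T% X) ((chartAt E x₀).symm z)) :
    mvfderiv 𝓘(ℝ, E) (fun y ↦ η y (X y)) ((chartAt E x₀).symm z) (Y ((chartAt E x₀).symm z)) =
      fderiv ℝ (chartForm η x₀) z (chartField Y x₀ z) (chartField X x₀ z) +
        chartForm η x₀ z (fderiv ℝ (chartField X x₀) z (chartField Y x₀ z)) := by
  have := FiniteDimensional.complete ℝ E
  have hω : DifferentiableAt ℝ (chartForm η x₀) z :=
    ((contDiffOn_chartForm hη x₀).contDiffAt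
      ((chartAt E x₀).open_target.mem_nhds hz)).differentiableAt (by simp)
  have hprod := hω.hasFDerivAt.clm_apply (differentiableAt_chartField hz hX).hasFDerivAt
  have hcomp := hasFDerivAt_comp_chartAt_symm (η := mvfderiv 𝓘(ℝ, E) (fun y ↦ η y (X y))) hz
    ((hη _ X hX).mdifferentiableAt (by simp)).hasMFDerivAt
  have heq : (fun y ↦ η y (X y)) ∘ (chartAt E x₀).symm =ᶠ[𝓝 z]
      fun w ↦ chartForm η x₀ w (chartField X x₀ w) := by
    filter_upwards [(chartAt E x₀).open_target.mem_nhds hz] with w hw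
    exact (chartForm_chartField hw).symm
  rw [← chartForm_chartField (η := mvfderiv 𝓘(ℝ, E) (fun y ↦ η y (X y))) hz,
    hcomp.unique (hprod.congr_of_eventuallyEq heq)]
  simp [add_comm]

theorem mvfderiv_apply_field_sub [FiniteDimensional ℝ E] (hη : SmoothOneForm η)
    (hz : z ∈ (chartAt E x₀).target)
    (hX : CMDiffAt ∞ (T% X) ((chartAt E x₀).symm z))
    (hY : CMDiffAt ∞ (T% Y) ((chartAt E x₀).symm z)) :
    mvfderiv 𝓘(ℝ, E) (fun y ↦ η y (Y y)) ((chartAt E x₀).symm z) (X ((chartAt E x₀).symm z)) -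
        mvfderiv 𝓘(ℝ, E) (fun y ↦ η y (X y)) ((chartAt E x₀).symm z) (Y ((chartAt E x₀).symm z)) -
        η ((chartAt E x₀).symm z) (mlieBracket 𝓘(ℝ, E) X Y ((chartAt E x₀).symm z)) =
      fderiv ℝ (chartForm η x₀) z (chartField X x₀ z) (chartField Y x₀ z) -
        fderiv ℝ (chartForm η x₀) z (chartField Y x₀ z) (chartField X x₀ z) := by
  have := FiniteDimensional.complete ℝ E
  rw [mvfderiv_apply_field hη hz hX, mvfderiv_apply_field hη hz hY,
    ← chartForm_chartField (X := mlieBracket 𝓘(ℝ, E) X Y) hz, chartField_mlieBracket hz hX hY,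
    lieBracket, map_sub]
  abel

theorem chartField_frameField (hz : z ∈ (chartAt E x₀).target) (b : E) :
    chartField (frameField x₀ b) x₀ z = b := by
  have h := (isInvertible_mfderiv_chartAt_symm hz).inverse_apply_self b
  rw [(hasMFDerivAt_chartAt_symm hz).mfderiv] at h
  rw [chartField, mpullback_apply, (hasMFDerivAt_chartAt_symm hz).mfderiv]
  exact h

theorem fderiv_chartForm_symm [FiniteDimensional ℝ E] (hη : SmoothOneForm η)
    (hc : ClosedOneForm η) (hz : z ∈ (chartAt E x₀).target) (a b : E) :
    fderiv ℝ (chartForm η x₀) z a b = fderiv ℝ (chartForm η x₀) z b a := by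
  have hframe := contMDiffAt_frameField ((chartAt E x₀).map_target hz)
  have h := mvfderiv_apply_field_sub hη hz (hframe a) (hframe b)
  rw [hc _ _ _ (hframe a) (hframe b), sub_self, chartField_frameField hz,
    chartField_frameField hz] at h
  exact sub_eq_zero.1 h.symm

theorem smoothOneForm_mvfderiv {f : M → V} (hf : CMDiff ∞ f) :
    SmoothOneForm (mvfderiv 𝓘(ℝ, E) f) := fun x _ hX ↦
  (contMDiff_snd_tangentBundle_modelSpace V 𝓘(ℝ, V)).contMDiffAt.comp x
    ((hf.contMDiff_tangentMap (m := ∞) (by simp)).contMDiffAt.comp x hX)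

theorem closedOneForm_mvfderiv [FiniteDimensional ℝ E] {f : M → V} (hf : CMDiff ∞ f) :
    ClosedOneForm (mvfderiv 𝓘(ℝ, E) f) := by
  intro x X Y hX hY
  have hz := mem_chart_target E x
  have hfψ : ContDiffAt ℝ ∞ (f ∘ (chartAt E x).symm) (chartAt E x x) :=
    ((hf _).comp _ (contMDiffAt_chartAt_symm hz)).contDiffAt
  have hform : chartForm (mvfderiv 𝓘(ℝ, E) f) x =ᶠ[𝓝 (chartAt E x x)]
      fderiv ℝ (f ∘ (chartAt E x).symm) := by
    filter_upwards [(chartAt E x).open_target.mem_nhds hz] with w hw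
    exact (hasFDerivAt_comp_chartAt_symm hw
      ((hf _).mdifferentiableAt (by simp)).hasMFDerivAt).fderiv.symm
  have hsymm := hfψ.isSymmSndFDerivAt (by simpa using ENat.LEInfty.out)
  have hx := (chartAt E x).left_inv (mem_chart_source E x)
  have h := mvfderiv_apply_field_sub (X := X) (Y := Y) (smoothOneForm_mvfderiv hf) hz
    (by rwa [hx]) (by rwa [hx])
  rw [hform.fderiv_eq, hsymm.eq, sub_self, hx] at h
  exact sub_eq_zero.1 h

theorem chartForm_comp_continuousLinearMapAt (hy : y ∈ (chartAt E x₀).source) :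
    (chartForm η x₀ (chartAt E x₀ y)).comp
      ((trivializationAt E (TangentSpace 𝓘(ℝ, E)) x₀).continuousLinearMapAt ℝ y) = η y := by
  ext v
  rw [chartForm, (chartAt E x₀).left_inv hy]
  exact congrArg (η y) ((trivializationAt E
    (TangentSpace 𝓘(ℝ, E)) x₀).symmL_continuousLinearMapAt hy v)

theorem exists_local_primitive [FiniteDimensional ℝ E] [CompleteSpace V] (hη : SmoothOneForm η)
    (hc : ClosedOneForm η) (x₀ : M) :
    ∃ u : M → V, ∀ᶠ y in 𝓝 x₀, HasMFDerivAt 𝓘(ℝ, E) 𝓘(ℝ, V) u y (η y) := by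
  set φ := chartAt E x₀
  obtain ⟨r, hr, hball⟩ := Metric.mem_nhds_iff.1
    (φ.open_target.mem_nhds (mem_chart_target E x₀))
  obtain ⟨w, hw⟩ := (convex_ball (φ x₀) r).exists_forall_hasFDerivAt_of_fderiv_symmetric
    Metric.isOpen_ball (((contDiffOn_chartForm hη x₀).mono hball).differentiableOn (by simp))
    fun z hz ↦ fderiv_chartForm_symm hη hc (hball hz)
  refine ⟨w ∘ φ, ?_⟩
  filter_upwards [φ.open_source.mem_nhds (mem_chart_source E x₀),
    (φ.continuousAt (mem_chart_source E x₀)).preimage_mem_nhds (Metric.ball_mem_nhds _ hr)]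
    with y hy hyr
  have hcomp := chartForm_comp_continuousLinearMapAt (η := η) hy
  exact ((hw _ hyr).hasMFDerivAt.comp y (hasMFDerivAt_chartAt hy)).congr_mfderiv hcomp

theorem eventually_eq_of_hasMFDerivAt_zero {w : M → V} {x : M}
    (hw : ∀ᶠ y in 𝓝 x, HasMFDerivAt 𝓘(ℝ, E) 𝓘(ℝ, V) w y
      (0 : TangentSpace 𝓘(ℝ, E) y →L[ℝ] V)) :
    ∀ᶠ y in 𝓝 x, w y = w x := by
  set φ := chartAt E x
  have hx := mem_chart_source E x
  have hψ : Tendsto φ.symm (𝓝 (φ x)) (𝓝 x) := by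
    simpa only [ContinuousAt, φ.left_inv hx] using φ.continuousAt_symm (φ.map_source hx)
  have hderiv : ∀ᶠ z in 𝓝 (φ x), HasFDerivAt (w ∘ φ.symm) (0 : E →L[ℝ] V) z := by
    filter_upwards [hψ.eventually hw, φ.open_target.mem_nhds (φ.map_source hx)] with z hz hzt
    simpa [chartForm] using hasFDerivAt_comp_chartAt_symm (η := 0) hzt hz
  obtain ⟨r, hr, hball⟩ := Metric.eventually_nhds_iff_ball.1 hderiv
  have hconst : ∀ z ∈ Metric.ball (φ x) r, (w ∘ φ.symm) z = (w ∘ φ.symm) (φ x) := fun z hz ↦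
    Metric.isOpen_ball.is_const_of_fderiv_eq_zero (convex_ball (φ x) r).isPreconnected
      (fun y hy ↦ (hball y hy).differentiableAt.differentiableWithinAt)
      (fun y hy ↦ (hball y hy).fderiv) hz (Metric.mem_ball_self hr)
  filter_upwards [(φ.continuousAt hx).preimage_mem_nhds (Metric.ball_mem_nhds _ hr),
    φ.open_source.mem_nhds hx] with y hy hys
  simpa only [Function.comp_apply, φ.left_inv hys, φ.left_inv hx] using hconst _ hy

theorem exists_primitive [FiniteDimensional ℝ E] [CompleteSpace V] [SimplyConnectedSpace M]
    (hη : SmoothOneForm η) (hc : ClosedOneForm η) :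
    ∃ F : M → V, ∀ x, HasMFDerivAt 𝓘(ℝ, E) 𝓘(ℝ, V) F x (η x) := by
  have : LocallyPathConnectedSpace M := ChartedSpace.locallyPathConnectedSpace E M
  choose u hu using exists_local_primitive hη hc
  obtain ⟨F, hF⟩ := exists_eventually_sub_eq_of_simplyConnected
    (U := fun i ↦ interior {y | HasMFDerivAt 𝓘(ℝ, E) 𝓘(ℝ, V) (u i) y (η y)})
    (fun _ ↦ isOpen_interior) (fun i ↦ mem_interior_iff_mem_nhds.2 (hu i)) fun i j x hx ↦ by
      refine eventually_eq_of_hasMFDerivAt_zero (E := E) (w := fun y ↦ u i y - u j y) ?_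
      filter_upwards [mem_interior_iff_mem_nhds.1 hx.1, mem_interior_iff_mem_nhds.1 hx.2]
        with y hi hj
      exact (HasMFDerivAt.sub hi hj).congr_mfderiv (sub_self (η y))
  refine ⟨F, fun x ↦ ?_⟩
  have hadd := (hu x).self_of_nhds.add (hasMFDerivAt_const (I := 𝓘(ℝ, E)) (F x - u x x) x)
  refine (hadd.congr_of_eventuallyEq ?_).congr_mfderiv (add_zero (η x))
  filter_upwards [hF x] with y hy
  simp only [Pi.add_apply, ← hy, add_sub_cancel]

theorem contMDiff_of_hasMFDerivAt [FiniteDimensional ℝ E] (hη : SmoothOneForm η) {F : M → V}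
    (hF : ∀ x, HasMFDerivAt 𝓘(ℝ, E) 𝓘(ℝ, V) F x (η x)) : CMDiff ∞ F := by
  intro x
  have hFψ : ∀ z ∈ (chartAt E x).target,
      HasFDerivAt (F ∘ (chartAt E x).symm) (chartForm η x z) z := fun z hz ↦
    hasFDerivAt_comp_chartAt_symm hz (hF _)
  have hsmooth : ContDiffOn ℝ ∞ (F ∘ (chartAt E x).symm) (chartAt E x).target := by
    rw [contDiffOn_infty_iff_fderiv_of_isOpen (chartAt E x).open_target]
    exact ⟨fun z hz ↦ (hFψ z hz).differentiableAt.differentiableWithinAt,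
      (contDiffOn_chartForm hη x).congr fun z hz ↦ (hFψ z hz).fderiv⟩
  rw [contMDiffAt_iff_source]
  exact (hsmooth.contDiffAt ((chartAt E x).open_target.mem_nhds
    (mem_chart_target E x))).contMDiffAt.contMDiffWithinAt

end OneForms

section SmoothFields

section Calculus

variable {E : Type*} [NormedAddCommGroup E] [NormedSpace ℝ E]
  {M : Type*} [TopologicalSpace M] [ChartedSpace E M]
  {F : Type*} [NormedAddCommGroup F] [NormedSpace ℝ F]
  {V : Type*} [NormedAddCommGroup V] [NormedSpace ℝ V]
  {L : M → F →L[ℝ] V} {x : M}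

theorem contMDiffAt_clm_of_apply [FiniteDimensional ℝ F]
    (h : ∀ v, ContMDiffAt 𝓘(ℝ, E) 𝓘(ℝ, V) ∞ (fun y ↦ L y v) x) :
    ContMDiffAt 𝓘(ℝ, E) 𝓘(ℝ, F →L[ℝ] V) ∞ L x := by
  let b := Module.finBasis ℝ F
  let c (i : Fin (Module.finrank ℝ F)) : F →L[ℝ] ℝ := LinearMap.toContinuousLinearMap (b.coord i)
  have hL : L = fun y ↦ ∑ i, ContinuousLinearMap.smulRightL ℝ F V (c i) (L y (b i)) := by
    ext y v
    conv_lhs => rw [← b.sum_repr v, map_sum]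
    simp [c]
  rw [hL]
  exact contMDiffAt_finsetSum fun i _ ↦
    (ContinuousLinearMap.smulRightL ℝ F V (c i)).contMDiff.contMDiffAt.comp x (h (b i))

theorem contMDiffAt_of_clm_apply_eq [CompleteSpace F] {w : M → F} {c : M → V}
    (hL : ContMDiffAt 𝓘(ℝ, E) 𝓘(ℝ, F →L[ℝ] V) ∞ L x)
    (hc : ContMDiffAt 𝓘(ℝ, E) 𝓘(ℝ, V) ∞ c x) (hLx : (L x).IsInvertible)
    (hw : ∀ᶠ y in 𝓝 x, L y (w y) = c y) : ContMDiffAt 𝓘(ℝ, E) 𝓘(ℝ, F) ∞ w x := by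
  obtain ⟨e, he⟩ := hLx
  have hinv : ContMDiffAt 𝓘(ℝ, E) 𝓘(ℝ, V →L[ℝ] F) ∞ (fun y ↦ (L y).inverse) x :=
    (he ▸ contDiffAt_map_inverse e).contMDiffAt.comp x hL
  have hinvertible : ∀ᶠ y in 𝓝 x, (L y).IsInvertible :=
    hL.continuousAt.eventually (he ▸ e.nhds)
  refine (hinv.clm_apply hc).congr_of_eventuallyEq ?_
  filter_upwards [hw, hinvertible] with y hy hLy
  rw [← hy, hLy.inverse_apply_self]

theorem isInvertible_of_pos [FiniteDimensional ℝ F] {B : F →L[ℝ] F →L[ℝ] ℝ}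
    (hB : ∀ v, v ≠ 0 → 0 < B v v) : B.IsInvertible := by
  have hinj : Function.Injective B := by
    refine (injective_iff_map_eq_zero B).2 fun v hv ↦ by_contra fun hne ↦ ?_
    exact (hB v hne).ne' (DFunLike.congr_fun hv v)
  have hrank : Module.finrank ℝ F = Module.finrank ℝ (F →L[ℝ] ℝ) :=
    Subspace.dual_finrank_eq.symm.trans LinearMap.toContinuousLinearMap.finrank_eq
  exact ⟨(LinearEquiv.ofInjectiveOfFinrankEq B.toLinearMap hinj hrank).toContinuousLinearEquiv, rfl⟩

end Calculus

variable {n : ℕ} {M : Type*} [TopologicalSpace M]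
  [ChartedSpace (EuclideanSpace ℝ (Fin n)) M] [IsManifold (𝓡 n) ∞ M]
  {m : Metric n M} {Q : EndoField n M} {x : M}

theorem exists_smoothFieldAt (x : M) (v : TangentSpace (𝓡 n) x) :
    ∃ X : VField n M, SmoothFieldAt X x ∧ X x = v :=
  ⟨FiberBundle.extend (EuclideanSpace ℝ (Fin n)) v, FiberBundle.contMDiffAt_extend ..,
    FiberBundle.extend_apply_self ..⟩

theorem SmoothFieldAt.diffFieldAt {X : VField n M} (hX : SmoothFieldAt X x) :
    DiffFieldAt X x :=
  hX.mdifferentiableAt (by simp)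

theorem EndoField.Smooth.apply (hQ : Q.Smooth) {X : VField n M}
    (hX : SmoothFieldAt X x) : SmoothFieldAt (fun y ↦ Q y (X y)) x :=
  (hQ x).clm_bundle_apply hX

theorem contMDiffAt_inner (m : Metric n M) {X Y : VField n M}
    (hX : SmoothFieldAt X x) (hY : SmoothFieldAt Y x) :
    ContMDiffAt (𝓡 n) 𝓘(ℝ, ℝ) ∞ (fun y ↦ m.inner y (X y) (Y y)) x := by
  let _ : RiemannianBundle (fun x : M ↦ TangentSpace (𝓡 n) x) := ⟨m.toRiemannianMetric⟩
  exact ContMDiffAt.inner_bundle (F := EuclideanSpace ℝ (Fin n)) hX hY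

theorem contMDiffAt_bilin
    (B : Π x : M, TangentSpace (𝓡 n) x →L[ℝ] TangentSpace (𝓡 n) x →L[ℝ] ℝ)
    (h : ∀ X Y : VField n M, SmoothFieldAt X x → SmoothFieldAt Y x →
      ContMDiffAt (𝓡 n) 𝓘(ℝ, ℝ) ∞ (fun y ↦ B y (X y) (Y y)) x) :
    ContMDiffAt (𝓡 n) ((𝓡 n).prod 𝓘(ℝ, EuclideanSpace ℝ (Fin n) →L[ℝ]
      EuclideanSpace ℝ (Fin n) →L[ℝ] ℝ)) ∞
      (fun y ↦ TotalSpace.mk' (EuclideanSpace ℝ (Fin n) →L[ℝ] EuclideanSpace ℝ (Fin n) →L[ℝ] ℝ)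
        (E := fun x : M ↦ TangentSpace (𝓡 n) x →L[ℝ] TangentSpace (𝓡 n) x →L[ℝ] ℝ) y (B y)) x := by
  rw [contMDiffAt_hom_bundle]
  refine ⟨contMDiffAt_id, contMDiffAt_clm_of_apply fun a ↦ contMDiffAt_clm_of_apply fun b ↦ ?_⟩
  have hframe := contMDiffAt_frameField (mem_chart_source (EuclideanSpace ℝ (Fin n)) x)
  refine (h _ _ (hframe a) (hframe b)).congr_of_eventuallyEq ?_
  filter_upwards [(trivializationAt (EuclideanSpace ℝ (Fin n))
    (TangentSpace (𝓡 n)) x).open_baseSet.mem_nhds (mem_baseSet_trivializationAt _ _ x)] with y hy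
  refine (inCoordinates_apply_eq₂ (F₁ := EuclideanSpace ℝ (Fin n))
    (F₂ := EuclideanSpace ℝ (Fin n)) (F₃ := ℝ) (E₁ := TangentSpace (M := M) (𝓡 n))
    (E₂ := TangentSpace (M := M) (𝓡 n)) (E₃ := Bundle.Trivial M ℝ) (x₀ := x) (ϕ := B y)
    (v := a) (w := b) hy hy (mem_univ _)).trans ?_
  rw [frameField, frameField, Trivialization.symmL_apply _ hy, Trivialization.symmL_apply _ hy]
  simp

theorem smoothFieldAt_of_inner (m : Metric n M) {W : VField n M}
    (h : ∀ Z : VField n M, SmoothFieldAt Z x →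
      ContMDiffAt (𝓡 n) 𝓘(ℝ, ℝ) ∞ (fun y ↦ m.inner y (W y) (Z y)) x) :
    SmoothFieldAt W x := by
  let e := trivializationAt (EuclideanSpace ℝ (Fin n)) (TangentSpace (M := M) (𝓡 n)) x
  have hx : x ∈ e.baseSet := mem_baseSet_trivializationAt _ _ x
  have hframe := contMDiffAt_frameField (mem_chart_source (EuclideanSpace ℝ (Fin n)) x)
  let G (y : M) : EuclideanSpace ℝ (Fin n) →L[ℝ] EuclideanSpace ℝ (Fin n) →L[ℝ] ℝ :=
    ((e.symmL ℝ y).precomp ℝ).comp ((m.inner y).comp (e.symmL ℝ y))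
  have hG : ContMDiffAt (𝓡 n) 𝓘(ℝ, EuclideanSpace ℝ (Fin n) →L[ℝ]
      EuclideanSpace ℝ (Fin n) →L[ℝ] ℝ) ∞ G x :=
    contMDiffAt_clm_of_apply fun a ↦ contMDiffAt_clm_of_apply fun b ↦
      contMDiffAt_inner m (hframe a) (hframe b)
  have hGpos (a : EuclideanSpace ℝ (Fin n)) (ha : a ≠ 0) : 0 < G x a a :=
    m.pos x _ fun h0 ↦ ha ((e.continuousLinearMapAt_symmL (R := ℝ) hx a).symm.trans
      ((congrArg _ h0).trans (map_zero _)))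
  refine (contMDiffAt_section x).2 (contMDiffAt_of_clm_apply_eq hG
    (c := fun y ↦ (m.inner y (W y)).comp (e.symmL ℝ y))
    (contMDiffAt_clm_of_apply fun b ↦ h _ (hframe b)) (isInvertible_of_pos hGpos) ?_)
  filter_upwards [e.open_baseSet.mem_nhds hx] with y hy
  ext b
  have hcoord : e.symmL ℝ y (e ⟨y, W y⟩).2 = W y :=
    (e.symmL_apply hy _).trans (e.symm_apply_apply_mk hy (W y))
  exact congrArg (fun v ↦ m.inner y v (e.symmL ℝ y b)) hcoord

theorem inner_grad (m : Metric n M) (φ : M → ℝ) (v : TangentSpace (𝓡 n) x) :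
    m.inner x (grad m φ x) v = mvfderiv (𝓡 n) φ x v :=
  inner_sharp m x _ v

theorem smoothFieldAt_grad (m : Metric n M) {φ : M → ℝ} (hφ : ContMDiff (𝓡 n) 𝓘(ℝ, ℝ) ∞ φ) :
    SmoothFieldAt (grad m φ) x :=
  smoothFieldAt_of_inner m fun Z hZ ↦
    (smoothOneForm_mvfderiv hφ x Z hZ).congr_of_eventuallyEq
      (.of_forall fun _ ↦ inner_grad m φ _)

/-- The metric `(u, v) ↦ ⟨Q² u, v⟩` of an injective self-adjoint smooth tensor field `Q`. -/
def squareMetric (m : Metric n M) (Q : EndoField n M) (hQ : Q.Smooth)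
    (hsa : ∀ (x : M) (u v : TangentSpace (𝓡 n) x), m.inner x (Q x u) v = m.inner x u (Q x v))
    (hinj : ∀ x, Function.Injective (Q x)) : Metric n M where
  inner x := (m.inner x).comp ((Q x).comp (Q x))
  symm x u v := by
    change m.inner x (Q x (Q x u)) v = m.inner x (Q x (Q x v)) u
    rw [hsa, hsa, m.symm]
  pos x v hv := by
    change 0 < m.inner x (Q x (Q x v)) v
    rw [hsa]
    exact m.pos x _ fun h ↦ hv (hinj x (h.trans (map_zero _).symm))
  isVonNBounded x := by
    let e := (LinearEquiv.ofInjectiveEndo (Q x).toLinearMap (hinj x)).toContinuousLinearEquiv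
    refine ((m.isVonNBounded x).image (e.symm : TangentSpace (𝓡 n) x →L[ℝ] _)).subset ?_
    refine fun v hv ↦ ⟨e v, ?_, e.symm_apply_apply v⟩
    exact (hsa x (Q x v) v).symm.trans_lt hv
  contMDiff _ := contMDiffAt_bilin (fun y ↦ (m.inner y).comp ((Q y).comp (Q y)))
    fun _ _ hX hY ↦ contMDiffAt_inner m (hQ.apply (hQ.apply hX)) hY

end SmoothFields

section InnerProducts

variable {E : Type*} [NormedAddCommGroup E] [NormedSpace ℝ E]
  {M : Type*} [TopologicalSpace M] [ChartedSpace E M]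
  {V : Type*} [NormedAddCommGroup V] [InnerProductSpace ℝ V] {a b : M → V} {x : M}

theorem contMDiffAt_inner_apply (ha : ContMDiffAt 𝓘(ℝ, E) 𝓘(ℝ, V) ∞ a x)
    (hb : ContMDiffAt 𝓘(ℝ, E) 𝓘(ℝ, V) ∞ b x) :
    ContMDiffAt 𝓘(ℝ, E) 𝓘(ℝ, ℝ) ∞ (fun y ↦ inner ℝ (a y) (b y)) x :=
  ContMDiffAt.comp (g := fun p : V × V ↦ inner ℝ p.1 p.2) x
    contDiff_inner.contMDiff.contMDiffAt (ha.prodMk_space hb)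

theorem mvfderiv_inner_apply (ha : MDifferentiableAt 𝓘(ℝ, E) 𝓘(ℝ, V) a x)
    (hb : MDifferentiableAt 𝓘(ℝ, E) 𝓘(ℝ, V) b x) (v : TangentSpace 𝓘(ℝ, E) x) :
    mvfderiv 𝓘(ℝ, E) (fun y ↦ inner ℝ (a y) (b y)) x v =
      inner ℝ (mvfderiv 𝓘(ℝ, E) a x v) (b x) + inner ℝ (a x) (mvfderiv 𝓘(ℝ, E) b x v) := by
  have hpair : HasMFDerivAt 𝓘(ℝ, E) 𝓘(ℝ, V × V) (fun y ↦ (a y, b y)) x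
      ((mvfderiv 𝓘(ℝ, E) a x).prod (mvfderiv 𝓘(ℝ, E) b x)) :=
    ⟨ha.continuousAt.prodMk hb.continuousAt, ha.hasMFDerivAt.2.prodMk hb.hasMFDerivAt.2⟩
  have hinner : HasFDerivAt (fun p : V × V ↦ inner ℝ p.1 p.2) (fderivInnerCLM ℝ (a x, b x))
      (a x, b x) := isBoundedBilinearMap_inner.hasFDerivAt _
  have hcomp : HasMFDerivAt 𝓘(ℝ, E) 𝓘(ℝ, ℝ) (fun y ↦ inner ℝ (a y) (b y)) x
      ((fderivInnerCLM ℝ (a x, b x)).comp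
        ((mvfderiv 𝓘(ℝ, E) a x).prod (mvfderiv 𝓘(ℝ, E) b x)) : TangentSpace 𝓘(ℝ, E) x →L[ℝ] ℝ) :=
    HasMFDerivAt.comp x hinner.hasMFDerivAt hpair
  exact (DFunLike.congr_fun hcomp.mfderiv v).trans (add_comm _ _)

variable [IsManifold 𝓘(ℝ, E) ∞ M] {F f : M → V}

theorem smoothOneForm_inner_mvfderiv (hF : CMDiff ∞ F) (hf : CMDiff ∞ f) :
    SmoothOneForm fun x ↦ (innerSL ℝ (F x)).comp (mvfderiv 𝓘(ℝ, E) f x) :=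
  fun x X hX ↦ contMDiffAt_inner_apply (hF x) (smoothOneForm_mvfderiv hf x X hX)

theorem closedOneForm_inner_mvfderiv [FiniteDimensional ℝ E] (hF : CMDiff ∞ F) (hf : CMDiff ∞ f)
    (hsymm : ∀ (x : M) (u v : TangentSpace 𝓘(ℝ, E) x),
      inner ℝ (mvfderiv 𝓘(ℝ, E) F x u) (mvfderiv 𝓘(ℝ, E) f x v) =
        inner ℝ (mvfderiv 𝓘(ℝ, E) F x v) (mvfderiv 𝓘(ℝ, E) f x u)) :
    ClosedOneForm fun x ↦ (innerSL ℝ (F x)).comp (mvfderiv 𝓘(ℝ, E) f x) := by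
  intro x X Y hX hY
  have hF' := (hF x).mdifferentiableAt (by simp)
  have hderiv {Z : Π x : M, TangentSpace 𝓘(ℝ, E) x} (hZ : CMDiffAt ∞ (T% Z) x) :=
    mvfderiv_inner_apply hF' ((smoothOneForm_mvfderiv hf x Z hZ).mdifferentiableAt (by simp))
  simp only [ContinuousLinearMap.comp_apply, innerSL_apply_apply]
  rw [hderiv hX, hderiv hY, hsymm, add_sub_add_left_eq_sub, ← inner_sub_right,
    closedOneForm_mvfderiv hf x X Y hX hY]

end InnerProducts

section UnitNormals

variable {n : ℕ} {M : Type*} [TopologicalSpace M] [ChartedSpace (EuclideanSpace ℝ (Fin n)) M]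
  {f N : M → EuclideanSpace ℝ (Fin (n + 1))} {x : M}

theorem IsUnitNormal.mdifferentiableAt (hN : IsUnitNormal f N) (x : M) :
    MDifferentiableAt (𝓡 n) (𝓡 (n + 1)) N x :=
  (hN.smooth x).mdifferentiableAt (by simp)

theorem inner_diff_normal_self (hN : IsUnitNormal f N) (x : M) (u : TangentSpace (𝓡 n) x) :
    inner ℝ (diff N x u) (N x) = 0 := by
  have h := mvfderiv_inner_apply (hN.mdifferentiableAt x) (hN.mdifferentiableAt x) u
  have hconst : (fun y ↦ inner ℝ (N y) (N y)) = fun _ : M ↦ (1 : ℝ) := by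
    ext y
    rw [real_inner_self_eq_norm_sq, hN.norm_eq_one, one_pow]
  rw [hconst, mvfderiv_const] at h
  have hsum : 0 = inner ℝ (diff N x u) (N x) + inner ℝ (N x) (diff N x u) := h
  linarith [real_inner_comm (N x) (diff N x u)]

theorem diff_add_smul_normal_injective (hf : IsSmoothImmersion (n := n) f)
    (hN : IsUnitNormal f N) (x : M) :
    Function.Injective ((diff (n := n) f x).toLinearMap.coprod
      (LinearMap.toSpanSingleton ℝ _ (N x))) := by
  refine (injective_iff_map_eq_zero _).2 ?_
  rintro ⟨v, t⟩ h
  have h : diff f x v + t • N x = 0 := by simpa using h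
  have ht : t = 0 := by
    have hinner := congrArg (fun w ↦ inner ℝ w (N x)) h
    simpa [inner_add_left, hN.normal, inner_smul_left, hN.norm_eq_one] using hinner
  subst ht
  exact Prod.ext (hf.2 x (by simpa using h)) rfl

theorem diff_add_smul_normal_inj (hf : IsSmoothImmersion (n := n) f) (hN : IsUnitNormal f N)
    {u v : TangentSpace (𝓡 n) x} {s t : ℝ} :
    diff f x u + s • N x = diff f x v + t • N x ↔ u = v ∧ s = t :=
  (diff_add_smul_normal_injective hf hN x).eq_iff (a := (u, s)) (b := (v, t)) |>.trans
    Prod.mk_inj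

theorem exists_eq_diff_add_smul_normal (hf : IsSmoothImmersion (n := n) f)
    (hN : IsUnitNormal f N) (x : M) (w : EuclideanSpace ℝ (Fin (n + 1))) :
    ∃ (v : TangentSpace (𝓡 n) x) (t : ℝ), diff f x v + t • N x = w := by
  have hrank : Module.finrank ℝ (TangentSpace (𝓡 n) x × ℝ) =
      Module.finrank ℝ (EuclideanSpace ℝ (Fin (n + 1))) := by
    rw [Module.finrank_prod, finrank_euclideanSpace_fin, Module.finrank_self]
    exact congrArg (· + 1) finrank_euclideanSpace_fin
  obtain ⟨⟨v, t⟩, h⟩ := (LinearMap.injective_iff_surjective_of_finrank_eq_finrank hrank).1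
    (diff_add_smul_normal_injective hf hN x) w
  exact ⟨v, t, h⟩

theorem ext_diff_normal (hf : IsSmoothImmersion (n := n) f) (hN : IsUnitNormal f N)
    {a b : EuclideanSpace ℝ (Fin (n + 1))}
    (htan : ∀ v : TangentSpace (𝓡 n) x, inner ℝ a (diff (n := n) f x v) =
      inner ℝ b (diff (n := n) f x v))
    (hnor : inner ℝ a (N x) = inner ℝ b (N x)) : a = b := by
  refine ext_inner_right ℝ fun w ↦ ?_
  obtain ⟨v, t, rfl⟩ := exists_eq_diff_add_smul_normal hf hN x w
  rw [inner_add_right, inner_add_right, inner_smul_right, inner_smul_right, htan, hnor]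

end UnitNormals

section Hypersurface

variable {n : ℕ} {M : Type*} [TopologicalSpace M]
  [ChartedSpace (EuclideanSpace ℝ (Fin n)) M] [IsManifold (𝓡 n) ∞ M]
  {m : Metric n M} {k : ℕ} {x : M} {X Y Z : VField n M}

theorem mdifferentiableAt_diff_apply {f : M → EuclideanSpace ℝ (Fin k)}
    (hf : ContMDiff (𝓡 n) (𝓡 k) ∞ f) (hX : SmoothFieldAt X x) :
    MDifferentiableAt (𝓡 n) (𝓡 k) (fun y ↦ diff f y (X y)) x :=
  (smoothOneForm_mvfderiv hf x X hX).mdifferentiableAt (by simp)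

theorem diff_mlieBracket {f : M → EuclideanSpace ℝ (Fin k)}
    (hf : ContMDiff (𝓡 n) (𝓡 k) ∞ f) (hX : SmoothFieldAt X x) (hY : SmoothFieldAt Y x) :
    diff f x (mlieBracket (𝓡 n) X Y x) =
      diff (fun y ↦ diff f y (Y y)) x (X x) - diff (fun y ↦ diff f y (X y)) x (Y x) :=
  (closedOneForm_mvfderiv hf x X Y hX hY).symm

theorem mvfderiv_metric_apply {f : M → EuclideanSpace ℝ (Fin k)} (hf : IsIsometricImmersion m f)
    (hY : SmoothFieldAt Y x) (hZ : SmoothFieldAt Z x) (v : TangentSpace (𝓡 n) x) :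
    mvfderiv (𝓡 n) (fun y ↦ m.inner y (Y y) (Z y)) x v =
      inner ℝ (diff (fun y ↦ diff f y (Y y)) x v) (diff f x (Z x)) +
        inner ℝ (diff f x (Y x)) (diff (fun y ↦ diff f y (Z y)) x v) := by
  simp only [← hf.2]
  exact mvfderiv_inner_apply (mdifferentiableAt_diff_apply hf.1.1 hY)
    (mdifferentiableAt_diff_apply hf.1.1 hZ) v

theorem inner_diff_diff {f : M → EuclideanSpace ℝ (Fin k)} (hf : IsIsometricImmersion m f)
    (hX : SmoothFieldAt X x) (hY : SmoothFieldAt Y x) (hZ : SmoothFieldAt Z x) :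
    inner ℝ (diff (fun y ↦ diff f y (Y y)) x (X x)) (diff f x (Z x)) =
      m.inner x (leviCivita m Y x (X x)) (Z x) := by
  have hkoszul : m.inner x (leviCivita m Y x (X x)) (Z x) = koszul m Y X Z x :=
    inner_leviCivitaFun m (SmoothFieldAt.diffFieldAt hY) (SmoothFieldAt.diffFieldAt hX)
      (SmoothFieldAt.diffFieldAt hZ)
  rw [hkoszul, koszul, mvfderiv_metric_apply hf hY hZ, mvfderiv_metric_apply hf hZ hX,
    mvfderiv_metric_apply hf hX hY, ← hf.2, ← hf.2, ← hf.2, diff_mlieBracket hf.1.1 hX hY,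
    diff_mlieBracket hf.1.1 hY hZ, diff_mlieBracket hf.1.1 hZ hX]
  simp only [inner_sub_left]
  rw [real_inner_comm _ (diff f x (Y x)), real_inner_comm _ (diff f x (Z x)),
    real_inner_comm _ (diff f x (X x))]
  ring

variable {f N : M → EuclideanSpace ℝ (Fin (n + 1))}

theorem eq_diff_add_smul_normal (hf : IsIsometricImmersion m f) (hN : IsUnitNormal f N)
    {w : EuclideanSpace ℝ (Fin (n + 1))} {u : TangentSpace (𝓡 n) x} {t : ℝ}
    (htan : ∀ v, inner ℝ w (diff f x v) = m.inner x u v) (hnor : inner ℝ w (N x) = t) :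
    w = diff f x u + t • N x := by
  refine ext_diff_normal (x := x) hf.1 hN (fun v ↦ ?_) ?_
  · rw [htan, inner_add_left, hf.2, inner_smul_left, real_inner_comm, hN.normal, mul_zero,
      add_zero]
  · rw [hnor, inner_add_left, hN.normal, inner_smul_left, real_inner_self_eq_norm_sq,
      hN.norm_eq_one]
    simp

theorem diff_normal (hf : IsIsometricImmersion m f) (hN : IsUnitNormal f N) (x : M)
    (u : TangentSpace (𝓡 n) x) :
    diff N x u = -diff f x (shapeOperator m f N x u) := by
  refine ext_diff_normal (x := x) hf.1 hN (fun v ↦ ?_) ?_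
  · rw [inner_neg_left, hf.2, inner_shapeOperator, neg_neg]
  · rw [inner_neg_left, hN.normal, inner_diff_normal_self hN, neg_zero]

theorem inner_diff_diff_normal (hf : ContMDiff (𝓡 n) (𝓡 (n + 1)) ∞ f) (hN : IsUnitNormal f N)
    (hY : SmoothFieldAt Y x) (u : TangentSpace (𝓡 n) x) :
    inner ℝ (diff (fun y ↦ diff f y (Y y)) x u) (N x) =
      m.inner x (shapeOperator m f N x u) (Y x) := by
  have h := mvfderiv_inner_apply (mdifferentiableAt_diff_apply hf hY) (hN.mdifferentiableAt x) u
  simp only [hN.normal] at h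
  rw [mvfderiv_const] at h
  have hsum : 0 = inner ℝ (diff (fun y ↦ diff f y (Y y)) x u) (N x) +
      inner ℝ (diff f x (Y x)) (diff N x u) := h
  rw [inner_shapeOperator]
  linarith [real_inner_comm (diff f x (Y x)) (diff N x u)]

theorem diff_diff (hf : IsIsometricImmersion m f) (hN : IsUnitNormal f N)
    (hY : SmoothFieldAt Y x) (u : TangentSpace (𝓡 n) x) :
    diff (fun y ↦ diff f y (Y y)) x u =
      diff f x (leviCivita m Y x u) + m.inner x (shapeOperator m f N x u) (Y x) • N x := by
  obtain ⟨X, hX, rfl⟩ := exists_smoothFieldAt x u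
  refine eq_diff_add_smul_normal hf hN (fun v ↦ ?_) (inner_diff_diff_normal hf.1.1 hN hY _)
  obtain ⟨Z, hZ, rfl⟩ := exists_smoothFieldAt x v
  exact inner_diff_diff hf hX hY hZ

theorem shapeOperator_selfAdjoint (hf : ContMDiff (𝓡 n) (𝓡 (n + 1)) ∞ f) (hN : IsUnitNormal f N)
    (x : M) (u v : TangentSpace (𝓡 n) x) :
    m.inner x (shapeOperator m f N x u) v = m.inner x u (shapeOperator m f N x v) := by
  obtain ⟨X, hX, rfl⟩ := exists_smoothFieldAt x u
  obtain ⟨Y, hY, rfl⟩ := exists_smoothFieldAt x v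
  have h := hN.normal x (mlieBracket (𝓡 n) X Y x)
  rw [diff_mlieBracket hf hX hY, inner_sub_left, inner_diff_diff_normal (m := m) hf hN hY,
    inner_diff_diff_normal (m := m) hf hN hX, sub_eq_zero] at h
  rw [h, m.symm]

theorem diff_diff_add_smul_normal (hf : IsIsometricImmersion m f) (hN : IsUnitNormal f N)
    {h : M → ℝ} (hY : SmoothFieldAt Y x) (hh : MDifferentiableAt (𝓡 n) 𝓘(ℝ, ℝ) h x)
    (u : TangentSpace (𝓡 n) x) :
    diff (fun y ↦ diff f y (Y y) + h y • N y) x u =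
      diff f x (leviCivita m Y x u - h x • shapeOperator m f N x u) +
        (m.inner x (shapeOperator m f N x u) (Y x) + mvfderiv (𝓡 n) h x u) • N x := by
  have hNx := hN.mdifferentiableAt x
  have hadd : diff (fun y ↦ diff f y (Y y) + h y • N y) x u = diff (fun y ↦ diff f y (Y y)) x u +
      (h x • diff N x u + mvfderiv (𝓡 n) h x u • N x) :=
    (DFunLike.congr_fun (mvfderiv_add (mdifferentiableAt_diff_apply hf.1.1 hY)
      (hh.smul hNx)) u).trans (congrArg (_ + ·) (DFunLike.congr_fun (mvfderiv_smul hh hNx) u))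
  rw [hadd, diff_diff hf hN hY, diff_normal hf hN, map_sub, map_smul, add_smul, smul_neg]
  abel

end Hypersurface
section CodazziTensors

variable {n : ℕ} {M : Type*} [TopologicalSpace M]
  [ChartedSpace (EuclideanSpace ℝ (Fin n)) M] [IsManifold (𝓡 n) ∞ M]
  {m : Metric n M} {k : ℕ} {Q : EndoField n M} {x : M}

theorem IsCodazzi.leviCivita_apply_sub (hQ : IsCodazzi m Q) {X Y : VField n M}
    (hX : SmoothFieldAt X x) (hY : SmoothFieldAt Y x) :
    leviCivita m (fun y ↦ Q y (Y y)) x (X x) - leviCivita m (fun y ↦ Q y (X y)) x (Y x) =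
      Q x (mlieBracket (𝓡 n) X Y x) := by
  have h := hQ.codazzi x X Y hX hY
  rw [← leviCivita_torsion_free m (SmoothFieldAt.diffFieldAt hX) (SmoothFieldAt.diffFieldAt hY),
    map_sub]
  rw [sub_eq_sub_iff_add_eq_add] at h ⊢
  rw [h, add_comm]

variable {f N F : M → EuclideanSpace ℝ (Fin (n + 1))}

theorem inner_shapeOperator_comm (hf : ContMDiff (𝓡 n) (𝓡 (n + 1)) ∞ f) (hN : IsUnitNormal f N)
    (hsa : ∀ (x : M) (u v : TangentSpace (𝓡 n) x), m.inner x (Q x u) v = m.inner x u (Q x v))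
    (hcomm : ∀ x, (Q x).comp (shapeOperator m f N x) = (shapeOperator m f N x).comp (Q x))
    (u v : TangentSpace (𝓡 n) x) :
    m.inner x (shapeOperator m f N x u) (Q x v) = m.inner x (shapeOperator m f N x v) (Q x u) := by
  have h : Q x (shapeOperator m f N x u) = shapeOperator m f N x (Q x u) :=
    DFunLike.congr_fun (hcomm x) u
  rw [← hsa, h, shapeOperator_selfAdjoint hf hN, m.symm]

theorem closedOneForm_diff_comp (hf : IsIsometricImmersion m f) (hN : IsUnitNormal f N)
    (hQ : IsCodazzi m Q)
    (hcomm : ∀ x, (Q x).comp (shapeOperator m f N x) = (shapeOperator m f N x).comp (Q x)) :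
    ClosedOneForm fun x ↦ (diff f x).comp (Q x) := fun x X Y hX hY ↦ calc
  diff (fun y ↦ diff f y (Q y (Y y))) x (X x) - diff (fun y ↦ diff f y (Q y (X y))) x (Y x)
    = diff f x (leviCivita m (fun y ↦ Q y (Y y)) x (X x) -
        leviCivita m (fun y ↦ Q y (X y)) x (Y x)) := by
      rw [diff_diff hf hN (hQ.smooth.apply hY), diff_diff hf hN (hQ.smooth.apply hX),
        inner_shapeOperator_comm hf.1.1 hN hQ.selfAdjoint hcomm (X x) (Y x),
        add_sub_add_right_eq_sub, map_sub]
  _ = diff f x (Q x (mlieBracket (𝓡 n) X Y x)) := by rw [hQ.leviCivita_apply_sub hX hY]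

theorem exists_contMDiff_diff_eq_comp [SimplyConnectedSpace M] (hf : IsIsometricImmersion m f)
    (hN : IsUnitNormal f N) (hQ : IsCodazzi m Q)
    (hcomm : ∀ x, (Q x).comp (shapeOperator m f N x) = (shapeOperator m f N x).comp (Q x)) :
    ∃ F : M → EuclideanSpace ℝ (Fin (n + 1)),
      ContMDiff (𝓡 n) (𝓡 (n + 1)) ∞ F ∧ ∀ x, diff (n := n) F x = (diff f x).comp (Q x) := by
  have hsmooth : SmoothOneForm fun x ↦ (diff f x).comp (Q x) := fun x _ hX ↦
    smoothOneForm_mvfderiv hf.1.1 x _ (hQ.smooth.apply hX)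
  obtain ⟨F, hF⟩ := exists_primitive hsmooth (closedOneForm_diff_comp hf hN hQ hcomm)
  exact ⟨F, contMDiff_of_hasMFDerivAt hsmooth hF, fun x ↦ (hF x).mfderiv⟩

theorem exists_contMDiff_inner_grad_eq [SimplyConnectedSpace M] (hf : IsIsometricImmersion m f)
    (hsa : ∀ (x : M) (u v : TangentSpace (𝓡 n) x), m.inner x (Q x u) v = m.inner x u (Q x v))
    (hF : ContMDiff (𝓡 n) (𝓡 (n + 1)) ∞ F)
    (hFQ : ∀ x, diff (n := n) F x = (diff f x).comp (Q x)) :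
    ∃ g : M → ℝ, ContMDiff (𝓡 n) 𝓘(ℝ, ℝ) ∞ g ∧ ∀ (x : M) (v : TangentSpace (𝓡 n) x),
      m.inner x (grad m g x) v = inner ℝ (F x) (diff f x v) := by
  have hsymm (x : M) (u v : TangentSpace (𝓡 n) x) :
      inner ℝ (diff F x u) (diff f x v) = inner ℝ (diff F x v) (diff f x u) := by
    rw [hFQ, ContinuousLinearMap.comp_apply, ContinuousLinearMap.comp_apply, hf.2, hf.2, hsa,
      m.symm]
  have hsmooth := smoothOneForm_inner_mvfderiv hF hf.1.1
  obtain ⟨g, hg⟩ := exists_primitive hsmooth (closedOneForm_inner_mvfderiv hF hf.1.1 hsymm)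
  exact ⟨g, contMDiff_of_hasMFDerivAt hsmooth hg, fun x v ↦
    (inner_grad m g v).trans (DFunLike.congr_fun (hg x).mfderiv v)⟩

theorem tangential_normal_of_eq_diff_add_smul_normal (hf : IsIsometricImmersion m f)
    (hN : IsUnitNormal f N) {Y : VField n M} {h : M → ℝ} (hY : SmoothFieldAt Y x)
    (hh : MDifferentiableAt (𝓡 n) 𝓘(ℝ, ℝ) h x)
    (hFQ : diff (n := n) F x = (diff f x).comp (Q x))
    (hF : ∀ y, F y = diff f y (Y y) + h y • N y) (u : TangentSpace (𝓡 n) x) :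
    Q x u = leviCivita m Y x u - h x • shapeOperator m f N x u ∧
      m.inner x (shapeOperator m f N x u) (Y x) + mvfderiv (𝓡 n) h x u = 0 := by
  have hdF := diff_diff_add_smul_normal hf hN hY hh u
  rw [← funext hF, hFQ, ContinuousLinearMap.comp_apply] at hdF
  have hdF0 := (add_zero _).trans hdF
  rw [← zero_smul ℝ (N x), diff_add_smul_normal_inj hf.1 hN] at hdF0
  exact ⟨hdF0.1, hdF0.2.symm⟩

theorem shapeOperator_eq_neg_grad (hf : ContMDiff (𝓡 n) (𝓡 (n + 1)) ∞ f) (hN : IsUnitNormal f N)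
    {v : TangentSpace (𝓡 n) x} {h : M → ℝ}
    (hv : ∀ u, m.inner x (shapeOperator m f N x u) v + mvfderiv (𝓡 n) h x u = 0) :
    shapeOperator m f N x v = -grad m h x := by
  refine eq_of_inner_eq m fun Z _ ↦ ?_
  rw [map_neg, neg_apply, inner_grad, shapeOperator_selfAdjoint hf hN, m.symm]
  exact eq_neg_of_add_eq_zero_left (hv _)

theorem isIsometricImmersion_squareMetric {f F : M → EuclideanSpace ℝ (Fin k)}
    (hf : IsIsometricImmersion m f) (hQ : Q.Smooth)
    (hsa : ∀ (x : M) (u v : TangentSpace (𝓡 n) x), m.inner x (Q x u) v = m.inner x u (Q x v))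
    (hinj : ∀ x, Function.Injective (Q x)) (hF : ContMDiff (𝓡 n) (𝓡 k) ∞ F)
    (hFQ : ∀ x, diff (n := n) F x = (diff f x).comp (Q x)) :
    IsIsometricImmersion (squareMetric m Q hQ hsa hinj) F := by
  refine ⟨⟨hF, fun x ↦ hFQ x ▸ (hf.1.2 x).comp (hinj x)⟩, fun x u v ↦ ?_⟩
  rw [hFQ]
  exact (hf.2 x _ _).trans (hsa x (Q x u) v).symm

end CodazziTensors

end

end CodazziHypersurface

theorem proposition3_general {n : ℕ} {M : Type*} [TopologicalSpace M]
    [ChartedSpace (EuclideanSpace ℝ (Fin n)) M] [IsManifold (𝓡 n) ∞ M] [SimplyConnectedSpace M]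
    (m : Metric n M)
    (f : M → EuclideanSpace ℝ (Fin (n + 1))) (hf : IsIsometricImmersion m f)
    (N : M → EuclideanSpace ℝ (Fin (n + 1))) (hN : IsUnitNormal f N)
    (A : EndoField n M) (hA : A = shapeOperator m f N)
    (Q : EndoField n M) (hQ : IsCodazzi m Q)
    (hcomm : ∀ x, (Q x).comp (A x) = (A x).comp (Q x)) :
    ∃ F : M → EuclideanSpace ℝ (Fin (n + 1)),
      ContMDiff (𝓡 n) (𝓡 (n + 1)) ∞ F ∧
      (∀ x, diff (n := n) F x = (diff f x).comp (Q x)) ∧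
      (∃ g h : M → ℝ,
        ContMDiff (𝓡 n) 𝓘(ℝ, ℝ) ∞ g ∧ ContMDiff (𝓡 n) 𝓘(ℝ, ℝ) ∞ h ∧
        (∀ x, A x (grad m g x) = -grad m h x) ∧
        (∀ (x : M) (u : TangentSpace (𝓡 n) x),
          Q x u = leviCivita m (grad m g) x u - h x • A x u) ∧
        (∀ x, F x = diff f x (grad m g x) + h x • N x)) ∧
      ((∀ x, Function.Injective (Q x)) →
        IsSmoothImmersion (n := n) F ∧
        ∃ m' : Metric n M,
          (∀ (x : M) (u v : TangentSpace (𝓡 n) x),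
            m'.inner x u v = m.inner x (Q x (Q x u)) v) ∧
          IsIsometricImmersion m' F) := by
  subst hA
  obtain ⟨F, hF, hFQ⟩ := exists_contMDiff_diff_eq_comp hf hN hQ hcomm
  obtain ⟨g, hg, hgrad⟩ := exists_contMDiff_inner_grad_eq hf hQ.selfAdjoint hF hFQ
  have hh : ContMDiff (𝓡 n) 𝓘(ℝ, ℝ) ∞ fun y ↦ inner ℝ (F y) (N y) := fun x ↦
    contMDiffAt_inner_apply (hF x) (hN.smooth x)
  have hdecomp (x : M) : F x = diff f x (grad m g x) + inner ℝ (F x) (N x) • N x :=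
    eq_diff_add_smul_normal hf hN (fun v ↦ (hgrad x v).symm) rfl
  have hparts (x : M) := tangential_normal_of_eq_diff_add_smul_normal hf hN
    (smoothFieldAt_grad m hg) ((hh x).mdifferentiableAt (by simp)) (hFQ x) hdecomp
  refine ⟨F, hF, hFQ, ⟨g, _, hg, hh, fun x ↦ ?_, fun x u ↦ (hparts x u).1, hdecomp⟩,
    fun hinj ↦ ?_⟩
  · exact shapeOperator_eq_neg_grad hf.1.1 hN fun u ↦ (hparts x u).2
  · have hiso := isIsometricImmersion_squareMetric hf hQ.smooth hQ.selfAdjoint hinj hF hFQ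
    exact ⟨hiso.1, _, fun _ _ _ ↦ rfl, hiso⟩

theorem proposition3 {n : ℕ} {M : Type*} [TopologicalSpace M]
    [ChartedSpace (EuclideanSpace ℝ (Fin n)) M] [IsManifold (𝓡 n) ∞ M]
    [T2Space M] [SecondCountableTopology M] [SimplyConnectedSpace M]
    (m : Metric n M)
    (f : M → EuclideanSpace ℝ (Fin (n + 1))) (hf : IsIsometricImmersion m f)
    (N : M → EuclideanSpace ℝ (Fin (n + 1))) (hN : IsUnitNormal f N)
    (A : EndoField n M) (hA : A = shapeOperator m f N)
    (Q : EndoField n M) (hQ : IsCodazzi m Q)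
    (hns : ∀ x, Function.Bijective (Q x))
    (hcomm : ∀ x, (Q x).comp (A x) = (A x).comp (Q x)) :
    ∃ F : M → EuclideanSpace ℝ (Fin (n + 1)),
      IsSmoothImmersion (n := n) F ∧
      (∀ x, diff (n := n) F x = (diff f x).comp (Q x)) ∧
      (∃ g h : M → ℝ,
        ContMDiff (𝓡 n) 𝓘(ℝ, ℝ) ∞ g ∧ ContMDiff (𝓡 n) 𝓘(ℝ, ℝ) ∞ h ∧
        (∀ x, A x (grad m g x) = -grad m h x) ∧
        (∀ (x : M) (u : TangentSpace (𝓡 n) x),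
          Q x u = leviCivita m (grad m g) x u - h x • A x u) ∧
        (∀ x, F x = diff f x (grad m g x) + h x • N x)) ∧
      (∃ m' : Metric n M,
        (∀ (x : M) (u v : TangentSpace (𝓡 n) x), m'.inner x u v = m.inner x (Q x (Q x u)) v) ∧
        IsIsometricImmersion m' F) := by
  obtain ⟨F, _, hFQ, hgh, hiso⟩ := proposition3_general m f hf N hN A hA Q hQ hcomm
  obtain ⟨hF, hmetric⟩ := hiso fun x ↦ (hns x).1
  exact ⟨F, hF, hFQ, hgh, hmetric⟩
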